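/- Let $d\ge 1$, let $A\subset[0,1)$ be a finite set with $s=|A|$ elements, and set $\varepsilon=1$ if $0\in A$ and $\varepsilon=0$ if $0\notin A$. Let $X=(v_1,\dots,v_n)$ be unit vectors in $\mathbb{C}^d$ (giving a set of $s$-angular lines) for which the angles $|\langle v_j,v_k\rangle|^2$, $j\ne k$, take values in $A$. Then $$ n\le\binom{s+d-1}{d-1}\binom{s-\varepsilon+d-1}{d-1}. $$ Further, if equality holds, then each angle $x=|\langle v_j,v_k\rangle|^2$, $j\ne k$, is a root of the polynomial $$ f(x)=x^{\varepsilon}\,P^{(d-1,\varepsilon)}_{s-\varepsilon}(2x-1), $$ where $P^{(\alpha,\beta)}_m(y)=\sum_{k=0}^{m}\frac{(m+\alpha+\beta+1)_k\,(\alpha+k+1)_{m-k}}{k!\,(m-k)!}\left(\frac{y-1}{2}\right)^k$ is the Jacobi polynomial of degree $m$ and $(x)_k=x(x+1)\cdots(x+k-1)$. -/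

import Mathlib

open Polynomial

/-- The Jacobi polynomial `P_n^{(α,β)}`,
`P_n^{(α,β)}(y) = ∑_{k=0}^n (n+α+β+1)_k (α+k+1)_{n-k} / (k! (n-k)!) * ((y-1)/2)^k`,
where `(x)_k = x(x+1)⋯(x+k-1)`. For `α > -1` this is the usual
`(α+1)_n / n! * ₂F₁(-n, n+α+β+1; α+1; (1-y)/2)`. -/
noncomputable def jacobiPoly (n : ℕ) (α β : ℝ) : ℝ[X] :=
  ∑ k ∈ Finset.range (n + 1),
    C ((ascPochhammer ℝ k).eval (n + α + β + 1) * (ascPochhammer ℝ (n - k)).eval (α + k + 1)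
        / (k.factorial * (n - k).factorial)) * (C (1 / 2) * (X - 1)) ^ k

/-- `v_1, …, v_n` are unit vectors in `ℂ^d` whose angles `|⟨v_j, v_k⟩|²`, `j ≠ k`, take values
in the finite set `A ⊆ [0,1)`. (As `1 ∉ A`, they span pairwise distinct lines.) -/
structure IsAngularSet {d n : ℕ} (v : Fin n → EuclideanSpace ℂ (Fin d)) (A : Finset ℝ) :
    Prop where
  norm_eq_one : ∀ j, ‖v j‖ = 1
  subset_Ico : ∀ a ∈ A, 0 ≤ a ∧ a < 1
  angle_mem : ∀ j k, j ≠ k → ‖inner ℂ (v j) (v k)‖ ^ 2 ∈ A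

/-- `ε(A) = 1` if `0 ∈ A`, and `ε(A) = 0` otherwise. -/
noncomputable def angleEps (A : Finset ℝ) : ℕ := if (0 : ℝ) ∈ A then 1 else 0

/-- `f(x) = x^ε P_{s-ε}^{(d-1,ε)}(2x-1)`. -/
noncomputable def tightAngularPoly (d s ε : ℕ) : ℝ[X] :=
  X ^ ε * (jacobiPoly (s - ε) ((d : ℝ) - 1) (ε : ℝ)).comp (2 * X - 1)

/-! Put `t = |A \ {0}|`, so `s = ε + t`, and let `a` be the monic polynomial with root set `A \
{0}`. The zonal functions `F_j(z) = ⟨v_j, z⟩^ε a(|⟨v_j, z⟩|²)` have bidegree `(ε + t, t)` on the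
sphere, and `F_j(v_k) = a(1) δ_jk` with `a(1) ≠ 0`. Hence they are independent, and counting
monomials gives the bound.

If equality holds, the `F_j` form a basis, so `sphereHom` is interpolated by values at the `v_j`
(`eq_sum_of_tight`). Comparing the set with a rotated copy shows that `∑ j, |⟨u, v_j⟩|^(2m)` is the
same for all unit `u` when `m ≤ ε + 2t` (`sum_pow_eq_of_tight`): a design property. Second
derivatives in `u` give a recursion that evaluates these moments as beta moments
(`moment_recursion`).

For the beta functional, the shifted Jacobi polynomial `J` of degree `t` is orthogonal to lower
degrees with extra weight `x^ε (1 - x)`. Let `D = a - J / lc(J)`, of degree below `t`. Since `x^ε (1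
- x) a` vanishes at every `|⟨v_k, v_i⟩|²`, orthogonality of `J` and `D` becomes `∑ x^ε (1 - x) D² =
0`, a sum of nonnegative terms. So `x^ε D`, and with it `x^ε J`, vanishes at every angle. -/

/-! ### Bihomogeneous functions on the complex sphere. -/

/-- Restrictions to the unit sphere of `ℂ^d` of the polynomials that are homogeneous of degree `a`
in the coordinates and homogeneous of degree `b` in their conjugates. -/
noncomputable def sphereHom (d a b : ℕ) :
    Submodule ℂ (Metric.sphere (0 : EuclideanSpace ℂ (Fin d)) 1 → ℂ) :=
  Submodule.span ℂ (Set.range fun (p : Sym (Fin d) a × Sym (Fin d) b) z =>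
    ((p.1 : Multiset (Fin d)).map fun i => z.1 i).prod *
      ((p.2 : Multiset (Fin d)).map fun i => star (z.1 i)).prod)

/-- The spanning monomials are indexed by pairs of multisets; an upper bound suffices, so their
independence on the sphere plays no role. -/
theorem finrank_sphereHom_le {d a b : ℕ} (hd : 1 ≤ d) :
    Module.finrank ℂ (sphereHom d a b) ≤
      (a + d - 1).choose (d - 1) * (b + d - 1).choose (d - 1) := by
  have key : ∀ a, Fintype.card (Sym (Fin d) a) = (a + d - 1).choose (d - 1) := by
    intro a
    rw [Sym.card_sym_eq_choose, Fintype.card_fin, add_comm d a]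
    exact Nat.choose_symm_of_eq_add (by omega)
  refine (finrank_range_le_card _).trans ?_
  rw [Fintype.card_prod, key, key]

instance {d a b : ℕ} : FiniteDimensional ℂ (sphereHom d a b) :=
  FiniteDimensional.span_of_finite ℂ (Set.finite_range _)

section SphereHom

variable {d a b : ℕ} {f : Metric.sphere (0 : EuclideanSpace ℂ (Fin d)) 1 → ℂ}

theorem one_mem_sphereHom :
    (fun _ => 1 : Metric.sphere (0 : EuclideanSpace ℂ (Fin d)) 1 → ℂ) ∈ sphereHom d 0 0 :=
  Submodule.subset_span ⟨(Sym.nil, Sym.nil), by ext z; simp⟩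

theorem coord_mul_mem_sphereHom (i : Fin d) (hf : f ∈ sphereHom d a b) :
    (fun z => z.1 i * f z) ∈ sphereHom d (a + 1) b := by
  induction hf using Submodule.span_induction with
  | mem f hf =>
    obtain ⟨p, rfl⟩ := hf
    exact Submodule.subset_span ⟨(i ::ₛ p.1, p.2), by
      ext z; simp only [Sym.coe_cons, Multiset.map_cons, Multiset.prod_cons]; ring⟩
  | zero =>
    convert Submodule.zero_mem (sphereHom d (a + 1) b) using 1
    ext z; simp
  | add f g _ _ hf hg =>
    convert Submodule.add_mem _ hf hg using 1
    ext z; simp [mul_add]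
  | smul c f _ hf =>
    convert Submodule.smul_mem _ c hf using 1
    ext z; simp [mul_left_comm]

theorem star_coord_mul_mem_sphereHom (i : Fin d) (hf : f ∈ sphereHom d a b) :
    (fun z => star (z.1 i) * f z) ∈ sphereHom d a (b + 1) := by
  induction hf using Submodule.span_induction with
  | mem f hf =>
    obtain ⟨p, rfl⟩ := hf
    exact Submodule.subset_span ⟨(p.1, i ::ₛ p.2), by
      ext z; simp only [Sym.coe_cons, Multiset.map_cons, Multiset.prod_cons]; ring⟩
  | zero =>
    convert Submodule.zero_mem (sphereHom d a (b + 1)) using 1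
    ext z; simp
  | add f g _ _ hf hg =>
    convert Submodule.add_mem _ hf hg using 1
    ext z; simp [mul_add]
  | smul c f _ hf =>
    convert Submodule.smul_mem _ c hf using 1
    ext z; simp [mul_left_comm]

theorem inner_mul_mem_sphereHom (w : EuclideanSpace ℂ (Fin d)) (hf : f ∈ sphereHom d a b) :
    (fun z => inner ℂ w z.1 * f z) ∈ sphereHom d (a + 1) b := by
  have h : (fun z : Metric.sphere (0 : EuclideanSpace ℂ (Fin d)) 1 => inner ℂ w z.1 * f z) =
      ∑ i, star (w i) • fun z => z.1 i * f z := by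
    ext z
    simp only [PiLp.inner_apply, RCLike.inner_apply, Finset.sum_apply, Pi.smul_apply, smul_eq_mul,
      Finset.sum_mul, starRingEnd_apply]
    exact Finset.sum_congr rfl fun i _ => by ring
  rw [h]
  exact Submodule.sum_mem _ fun i _ => Submodule.smul_mem _ _ (coord_mul_mem_sphereHom i hf)

theorem star_inner_mul_mem_sphereHom (w : EuclideanSpace ℂ (Fin d)) (hf : f ∈ sphereHom d a b) :
    (fun z => star (inner ℂ w z.1) * f z) ∈ sphereHom d a (b + 1) := by
  have h : (fun z : Metric.sphere (0 : EuclideanSpace ℂ (Fin d)) 1 =>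
      star (inner ℂ w z.1) * f z) = ∑ i, w i • fun z => star (z.1 i) * f z := by
    ext z
    simp only [PiLp.inner_apply, RCLike.inner_apply, Finset.sum_apply, Pi.smul_apply, smul_eq_mul,
      Finset.sum_mul, starRingEnd_apply, star_sum, star_mul, star_star]
    exact Finset.sum_congr rfl fun i _ => by ring
  rw [h]
  exact Submodule.sum_mem _ fun i _ => Submodule.smul_mem _ _ (star_coord_mul_mem_sphereHom i hf)

/-- On the sphere a function may be multiplied by `∑ z_i conj(z_i) = 1`. -/
theorem sphereHom_le_succ : sphereHom d a b ≤ sphereHom d (a + 1) (b + 1) := by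
  intro f hf
  have h : f = ∑ i, fun z => z.1 i * (star (z.1 i) * f z) := by
    ext z
    have hz : ∑ i, z.1 i * star (z.1 i) = 1 := by
      have h1 : ‖z.1‖ ^ 2 = 1 := by simp
      rw [EuclideanSpace.norm_sq_eq] at h1
      have h2 := congrArg (fun x : ℝ => (x : ℂ)) h1
      simp only [Complex.ofReal_sum, Complex.ofReal_pow, Complex.ofReal_one] at h2
      rw [← h2]
      exact Finset.sum_congr rfl fun i _ => by
        rw [← Complex.conj_mul', starRingEnd_apply, mul_comm]
    simp only [Finset.sum_apply, ← mul_assoc, ← Finset.sum_mul, hz, one_mul]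
  rw [h]
  exact Submodule.sum_mem _ fun i _ =>
    coord_mul_mem_sphereHom i (star_coord_mul_mem_sphereHom i hf)

theorem sphereHom_le_add (m : ℕ) : sphereHom d a b ≤ sphereHom d (a + m) (b + m) := by
  induction m with
  | zero => exact le_rfl
  | succ m ih => exact ih.trans sphereHom_le_succ

end SphereHom

/-! ### Zonal functions. -/

/-- The zonal function `z ↦ ⟨w, z⟩^ε h(|⟨w, z⟩|²)`. -/
noncomputable def zonal {d : ℕ} (ε : ℕ) (h : ℝ[X]) (w z : EuclideanSpace ℂ (Fin d)) : ℂ :=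
  inner ℂ w z ^ ε * (h.eval (‖inner ℂ w z‖ ^ 2) : ℝ)

section Zonal

variable {d : ℕ} (ε : ℕ)

theorem zonal_X_pow_mem_sphereHom (w : EuclideanSpace ℂ (Fin d)) (i : ℕ) :
    (fun z : Metric.sphere (0 : EuclideanSpace ℂ (Fin d)) 1 => zonal ε (X ^ i) w z.1) ∈
      sphereHom d (ε + i) i := by
  induction i with
  | zero =>
    induction ε with
    | zero => simpa [zonal] using one_mem_sphereHom
    | succ ε ih =>
      convert inner_mul_mem_sphereHom w ih using 2 with z
      simp only [zonal]
      ring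
  | succ i ih =>
    change _ ∈ sphereHom d (ε + i + 1) (i + 1)
    convert inner_mul_mem_sphereHom w (star_inner_mul_mem_sphereHom w ih) using 1
    ext z
    rw [← mul_assoc, ← starRingEnd_apply, Complex.mul_conj']
    simp only [zonal, eval_pow, eval_X]
    push_cast
    ring

theorem zonal_mem_sphereHom (w : EuclideanSpace ℂ (Fin d)) {t : ℕ} {h : ℝ[X]}
    (hh : h.natDegree ≤ t) :
    (fun z : Metric.sphere (0 : EuclideanSpace ℂ (Fin d)) 1 => zonal ε h w z.1) ∈
      sphereHom d (ε + t) t := by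
  have e : (fun z : Metric.sphere (0 : EuclideanSpace ℂ (Fin d)) 1 => zonal ε h w z.1) =
      ∑ i ∈ Finset.range (t + 1), (h.coeff i : ℂ) • fun z => zonal ε (X ^ i) w z.1 := by
    ext z
    simp only [zonal, Finset.sum_apply, Pi.smul_apply, smul_eq_mul, eval_pow, eval_X,
      eval_eq_sum_range' (Nat.lt_succ_of_le hh), Complex.ofReal_sum, Finset.mul_sum]
    push_cast
    exact Finset.sum_congr rfl fun i _ => by ring
  rw [e]
  refine Submodule.sum_mem _ fun i hi => Submodule.smul_mem _ _ ?_
  obtain ⟨m, rfl⟩ := Nat.exists_eq_add_of_le (Nat.lt_succ_iff.1 (Finset.mem_range.1 hi))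
  rw [← add_assoc]
  exact sphereHom_le_add m (zonal_X_pow_mem_sphereHom ε w i)

theorem star_zonal (h : ℝ[X]) (w z : EuclideanSpace ℂ (Fin d)) :
    star (zonal ε h w z) = zonal ε h z w := by
  simp only [zonal, ← starRingEnd_apply, map_mul, map_pow, Complex.conj_ofReal, inner_conj_symm,
    norm_inner_symm w z]

theorem zonal_map (g : EuclideanSpace ℂ (Fin d) →ₗᵢ[ℂ] EuclideanSpace ℂ (Fin d)) (h : ℝ[X])
    (w z : EuclideanSpace ℂ (Fin d)) : zonal ε h (g w) (g z) = zonal ε h w z := by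
  simp only [zonal, g.inner_map_map]

/-- Conjugation cancels the phase of `⟨w, z⟩^ε`, leaving a polynomial in the angle. -/
theorem zonal_mul_star_zonal (h k : ℝ[X]) (w z : EuclideanSpace ℂ (Fin d)) :
    zonal ε h w z * star (zonal ε k w z) =
      ((X ^ ε * h * k).eval (‖inner ℂ w z‖ ^ 2) : ℝ) := by
  simp only [zonal, ← starRingEnd_apply, map_mul, map_pow, Complex.conj_ofReal, eval_mul, eval_pow,
    eval_X, Complex.ofReal_mul, Complex.ofReal_pow]
  rw [← Complex.mul_conj']
  ring

end Zonal

/-! ### Independence of the zonal family, and interpolation in the tight case. -/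

section Angular

variable {d n : ℕ} {v : Fin n → EuclideanSpace ℂ (Fin d)} {A : Finset ℝ}

/-- The monic polynomial whose roots are the nonzero elements of `A`. -/
noncomputable def annihilator (A : Finset ℝ) : ℝ[X] := ∏ a ∈ A.erase 0, (X - C a)

theorem monic_annihilator (A : Finset ℝ) : (annihilator A).Monic :=
  monic_prod_X_sub_C _ _

theorem natDegree_annihilator (A : Finset ℝ) :
    (annihilator A).natDegree = (A.erase 0).card := by
  simp [annihilator]

theorem card_eq_angleEps_add (A : Finset ℝ) : A.card = angleEps A + (A.erase 0).card := by
  unfold angleEps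
  split_ifs with h
  · rw [Finset.card_erase_of_mem h]
    have := Finset.card_pos.2 ⟨0, h⟩
    omega
  · rw [Finset.erase_eq_of_notMem h, zero_add]

theorem pow_angleEps_mul_annihilator {x : ℝ} (hx : x ∈ A) :
    x ^ angleEps A * (annihilator A).eval x = 0 := by
  by_cases h0 : x = 0
  · subst h0
    simp [angleEps, hx]
  · have : (annihilator A).eval x = 0 := by
      rw [annihilator, eval_prod]
      exact Finset.prod_eq_zero (Finset.mem_erase.2 ⟨h0, hx⟩) (by simp)
    rw [this, mul_zero]

namespace IsAngularSet

theorem annihilator_eval_one_ne_zero (hv : IsAngularSet v A) : (annihilator A).eval 1 ≠ 0 := by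
  rw [annihilator, eval_prod, Finset.prod_ne_zero_iff]
  intro a ha
  have := (hv.subset_Ico a (Finset.mem_of_mem_erase ha)).2
  simp only [eval_sub, eval_X, eval_C]
  linarith

theorem zonal_annihilator_self (hv : IsAngularSet v A) (j : Fin n) :
    zonal (angleEps A) (annihilator A) (v j) (v j) = ((annihilator A).eval 1 : ℝ) := by
  simp [zonal, inner_self_eq_norm_sq_to_K, hv.norm_eq_one]

theorem zonal_annihilator_of_ne (hv : IsAngularSet v A) {j k : Fin n} (h : j ≠ k) :
    zonal (angleEps A) (annihilator A) (v j) (v k) = 0 := by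
  have h1 := pow_angleEps_mul_annihilator (hv.angle_mem j k h)
  simp only [zonal, mul_eq_zero, pow_eq_zero_iff', norm_eq_zero, Complex.ofReal_eq_zero] at h1 ⊢
  tauto

theorem map (hv : IsAngularSet v A)
    (g : EuclideanSpace ℂ (Fin d) →ₗᵢ[ℂ] EuclideanSpace ℂ (Fin d)) :
    IsAngularSet (fun j => g (v j)) A where
  norm_eq_one j := by rw [g.norm_map, hv.norm_eq_one]
  subset_Ico := hv.subset_Ico
  angle_mem j k h := by
    rw [g.inner_map_map]
    exact hv.angle_mem j k h

/-- The zonal functions of the annihilator polynomial centred at the vectors `v j`. -/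
noncomputable def zonalFamily (v : Fin n → EuclideanSpace ℂ (Fin d)) (A : Finset ℝ) (j : Fin n) :
    sphereHom d (angleEps A + (A.erase 0).card) (A.erase 0).card :=
  ⟨fun z => zonal (angleEps A) (annihilator A) (v j) z.1,
    zonal_mem_sphereHom _ _ (natDegree_annihilator A).le⟩

theorem sum_smul_zonalFamily_apply (hv : IsAngularSet v A) (c : Fin n → ℂ) (k : Fin n) :
    (∑ j, c j • zonalFamily v A j).1 ⟨v k, by simp [hv.norm_eq_one]⟩ =
      c k * ((annihilator A).eval 1 : ℝ) := by
  have h : (∑ j, c j • zonalFamily v A j).1 ⟨v k, by simp [hv.norm_eq_one]⟩ =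
      ∑ j, c j * zonal (angleEps A) (annihilator A) (v j) (v k) := by
    simp [zonalFamily]
  rw [h, Finset.sum_eq_single k, hv.zonal_annihilator_self]
  · intro j _ hj
    rw [hv.zonal_annihilator_of_ne hj, mul_zero]
  · simp

theorem linearIndependent_zonalFamily (hv : IsAngularSet v A) :
    LinearIndependent ℂ (zonalFamily v A) := by
  rw [Fintype.linearIndependent_iff]
  intro c hc k
  have h := hv.sum_smul_zonalFamily_apply c k
  rw [hc] at h
  have h1 : c k * ((annihilator A).eval 1 : ℝ) = 0 := by rw [← h]; rfl
  have h2 := hv.annihilator_eval_one_ne_zero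
  simpa [h2] using h1

theorem card_le_finrank (hv : IsAngularSet v A) :
    n ≤ Module.finrank ℂ
      (sphereHom d (angleEps A + (A.erase 0).card) (A.erase 0).card) := by
  simpa using hv.linearIndependent_zonalFamily.fintype_card_le_finrank

/-- In a tight angular set, functions in `sphereHom` are interpolated by their values on the
set. -/
theorem eq_sum_of_tight (hv : IsAngularSet v A)
    (hn : n = Module.finrank ℂ
      (sphereHom d (angleEps A + (A.erase 0).card) (A.erase 0).card))
    {h : ℝ[X]} (hh : h.natDegree ≤ (A.erase 0).card) (w z : EuclideanSpace ℂ (Fin d))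
    (hz : ‖z‖ = 1) :
    zonal (angleEps A) h w z * ((annihilator A).eval 1 : ℝ) =
      ∑ j, zonal (angleEps A) h w (v j) * zonal (angleEps A) (annihilator A) (v j) z := by
  have hspan := hv.linearIndependent_zonalFamily.span_eq_top_of_card_eq_finrank' (by simpa using hn)
  have hm : (⟨_, zonal_mem_sphereHom (angleEps A) w hh⟩ :
      sphereHom d (angleEps A + (A.erase 0).card) (A.erase 0).card) ∈
      Submodule.span ℂ (Set.range (zonalFamily v A)) := by
    rw [hspan]; trivial
  obtain ⟨c, hc⟩ := (Submodule.mem_span_range_iff_exists_fun ℂ).1 hm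
  have h1 : ∀ k, zonal (angleEps A) h w (v k) = c k * ((annihilator A).eval 1 : ℝ) := by
    intro k
    rw [← hv.sum_smul_zonalFamily_apply c k, hc]
  have h2 : zonal (angleEps A) h w z =
      (∑ j, c j • zonalFamily v A j).1 ⟨z, by simp [hz]⟩ := by rw [hc]
  rw [h2]
  simp only [h1, zonalFamily, AddSubmonoidClass.coe_finsetSum, SetLike.val_smul, Finset.sum_apply,
    Pi.smul_apply, smul_eq_mul, Finset.sum_mul]
  exact Finset.sum_congr rfl fun j _ => by ring

end IsAngularSet

end Angular

/-! ### Rotation invariance of the moments, and their recursion. -/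

section Moments

variable {d n : ℕ} {v : Fin n → EuclideanSpace ℂ (Fin d)} {A : Finset ℝ}

theorem exists_linearIsometry_map_eq {u w : EuclideanSpace ℂ (Fin d)} (hu : ‖u‖ = 1)
    (hw : ‖w‖ = 1) :
    ∃ g : EuclideanSpace ℂ (Fin d) →ₗᵢ[ℂ] EuclideanSpace ℂ (Fin d), g u = w := by
  let e := LinearIsometryEquiv.toSpanUnitSingleton (𝕜 := ℂ) u hu
  refine ⟨((LinearIsometry.toSpanSingleton ℂ _ hw).comp e.symm.toLinearIsometry).extend, ?_⟩
  have h1 := LinearIsometry.extend_apply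
    ((LinearIsometry.toSpanSingleton ℂ _ hw).comp e.symm.toLinearIsometry) (e 1)
  have h2 : ((e 1 : Submodule.span ℂ {u}) : EuclideanSpace ℂ (Fin d)) = u := by simp [e]
  rw [h2] at h1
  rw [h1]
  simp

/-- With `g u = w`, both sides reduce to one double sum over the `v_j` and the `g v_i`: interpolate
the `h`-factor from the `v_j`, or the `k`-factor from the `g v_i`. The kernel of the annihilator is
Hermitian, so the two expansions agree. -/
theorem IsAngularSet.sum_eval_eq_of_tight (hv : IsAngularSet v A)
    (hn : n = Module.finrank ℂ
      (sphereHom d (angleEps A + (A.erase 0).card) (A.erase 0).card))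
    {h k : ℝ[X]} (hh : h.natDegree ≤ (A.erase 0).card) (hk : k.natDegree ≤ (A.erase 0).card)
    {u w : EuclideanSpace ℂ (Fin d)} (hu : ‖u‖ = 1) (hw : ‖w‖ = 1) :
    ∑ j, (X ^ angleEps A * h * k).eval (‖inner ℂ u (v j)‖ ^ 2) =
      ∑ j, (X ^ angleEps A * h * k).eval (‖inner ℂ w (v j)‖ ^ 2) := by
  obtain ⟨g, rfl⟩ := exists_linearIsometry_map_eq hu hw
  have hc : (((annihilator A).eval 1 : ℝ) : ℂ) ≠ 0 :=
    Complex.ofReal_ne_zero.2 hv.annihilator_eval_one_ne_zero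
  have hv' := hv.map g
  apply Complex.ofReal_injective
  simp only [Complex.ofReal_sum, ← zonal_mul_star_zonal]
  simp only [← zonal_map (angleEps A) g _ u]
  apply mul_right_cancel₀ hc
  rw [Finset.sum_mul, Finset.sum_mul]
  calc _ = ∑ i, ∑ j, zonal (angleEps A) h (g u) (v j) *
          zonal (angleEps A) (annihilator A) (v j) (g (v i)) *
          star (zonal (angleEps A) k (g u) (g (v i))) := by
        refine Finset.sum_congr rfl fun i _ => ?_
        rw [mul_right_comm, hv.eq_sum_of_tight hn hh (g u) (g (v i)) (hv'.norm_eq_one i),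
          Finset.sum_mul]
    _ = ∑ j, ∑ i, zonal (angleEps A) h (g u) (v j) *
          zonal (angleEps A) (annihilator A) (v j) (g (v i)) *
          star (zonal (angleEps A) k (g u) (g (v i))) := Finset.sum_comm
    _ = _ := by
        refine Finset.sum_congr rfl fun j _ => ?_
        have h1 := congrArg star
          (hv'.eq_sum_of_tight hn hk (g u) (v j) (hv.norm_eq_one j))
        simp only [star_mul', star_sum, star_zonal _ (annihilator A)] at h1
        rw [← starRingEnd_apply, ← starRingEnd_apply, Complex.conj_ofReal, starRingEnd_apply] at h1
        rw [mul_assoc, h1, Finset.mul_sum]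
        exact Finset.sum_congr rfl fun i _ => by ring

theorem IsAngularSet.sum_pow_eq_of_tight (hv : IsAngularSet v A)
    (hn : n = Module.finrank ℂ
      (sphereHom d (angleEps A + (A.erase 0).card) (A.erase 0).card))
    {m : ℕ} (hm : m ≤ angleEps A + 2 * (A.erase 0).card)
    {u w : EuclideanSpace ℂ (Fin d)} (hu : ‖u‖ = 1) (hw : ‖w‖ = 1) :
    ∑ j, (‖inner ℂ u (v j)‖ ^ 2) ^ m = ∑ j, (‖inner ℂ w (v j)‖ ^ 2) ^ m := by
  -- When `ε = 1` the product `X^ε h k` never yields the power `0`, which is trivial anyway.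
  rcases Nat.eq_zero_or_pos m with rfl | hpos
  · simp
  have hε : angleEps A ≤ 1 := by unfold angleEps; split_ifs <;> simp
  obtain ⟨i, l, hi, hl, rfl⟩ : ∃ i l, i ≤ (A.erase 0).card ∧ l ≤ (A.erase 0).card ∧
      m = angleEps A + i + l := by
    rcases le_total (m - angleEps A) (A.erase 0).card with h | h
    · exact ⟨m - angleEps A, 0, h, Nat.zero_le _, by omega⟩
    · exact ⟨(A.erase 0).card, m - angleEps A - (A.erase 0).card, le_rfl, by omega, by omega⟩
  have := hv.sum_eval_eq_of_tight hn (h := X ^ i) (k := X ^ l) (by simpa using hi)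
    (by simpa using hl) hu hw
  simpa [← pow_add] using this

theorem iterate_derivative_two_pow_eval_zero (a b c : ℝ) (m : ℕ) :
    (derivative^[2] ((C a + C (2 * c) * X + C b * X ^ 2) ^ m)).eval 0 =
      2 * m * a ^ (m - 1) * b + 4 * (m * (m - 1)) * a ^ (m - 2) * c ^ 2 := by
  rcases m with _ | _ | m
  · simp
  · simp [derivative_pow, derivative_mul]
    ring
  · simp [derivative_pow, derivative_mul]
    ring

theorem norm_inner_add_smul_sq (w e x : EuclideanSpace ℂ (Fin d)) (r : ℝ) :
    ‖inner ℂ (w + (r : ℂ) • e) x‖ ^ 2 =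
      ‖inner ℂ w x‖ ^ 2 + 2 * (inner ℂ w x * star (inner ℂ e x)).re * r +
        ‖inner ℂ e x‖ ^ 2 * r ^ 2 := by
  rw [inner_add_left, inner_smul_left, Complex.conj_ofReal]
  simp only [← Complex.normSq_eq_norm_sq, Complex.normSq_apply, Complex.add_re, Complex.add_im,
    Complex.mul_re, Complex.mul_im, Complex.ofReal_re, Complex.ofReal_im, ← starRingEnd_apply,
    Complex.conj_re, Complex.conj_im]
  ring

theorem norm_add_smul_sq (w e : EuclideanSpace ℂ (Fin d)) (hw : ‖w‖ = 1) (he : ‖e‖ = 1) (r : ℝ) :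
    ‖w + (r : ℂ) • e‖ ^ 2 = 1 + 2 * (inner ℂ w e).re * r + 1 * r ^ 2 := by
  rw [@norm_add_sq ℂ, inner_smul_right, norm_smul, hw, he]
  simp
  ring

/-- Comparison of the coefficients of `r ^ 2` in `∑ j, |⟨w + r e, v j⟩|^(2m)`. -/
theorem sum_second_coeff {m : ℕ} {S : ℝ}
    (hS : ∀ w : EuclideanSpace ℂ (Fin d), ∑ j, (‖inner ℂ w (v j)‖ ^ 2) ^ m = S * (‖w‖ ^ 2) ^ m)
    {w e : EuclideanSpace ℂ (Fin d)} (hw : ‖w‖ = 1) (he : ‖e‖ = 1) :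
    ∑ j, (2 * m * (‖inner ℂ w (v j)‖ ^ 2) ^ (m - 1) * ‖inner ℂ e (v j)‖ ^ 2 +
        4 * (m * (m - 1)) * (‖inner ℂ w (v j)‖ ^ 2) ^ (m - 2) *
          (inner ℂ w (v j) * star (inner ℂ e (v j))).re ^ 2) =
      S * (2 * m + 4 * (m * (m - 1)) * (inner ℂ w e).re ^ 2) := by
  have hpoly : ∑ j, (C (‖inner ℂ w (v j)‖ ^ 2) +
        C (2 * (inner ℂ w (v j) * star (inner ℂ e (v j))).re) * X +
          C (‖inner ℂ e (v j)‖ ^ 2) * X ^ 2) ^ m =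
      C S * (C 1 + C (2 * (inner ℂ w e).re) * X + C 1 * X ^ 2) ^ m := by
    refine Polynomial.funext fun r => ?_
    have := hS (w + (r : ℂ) • e)
    simp only [norm_inner_add_smul_sq, norm_add_smul_sq w e hw he] at this
    simpa [eval_finsetSum] using this
  have h2 := congrArg (fun p => (derivative^[2] p).eval 0) hpoly
  simp only [iterate_derivative_sum, eval_finsetSum, iterate_derivative_C_mul, eval_C_mul,
    iterate_derivative_two_pow_eval_zero] at h2
  simpa using h2

/-- Adding the identities for `e` and `i e` turns squared real parts into squared moduli, removing
the phases. -/
theorem sum_second_coeff_average {m : ℕ} {S : ℝ}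
    (hS : ∀ w : EuclideanSpace ℂ (Fin d), ∑ j, (‖inner ℂ w (v j)‖ ^ 2) ^ m = S * (‖w‖ ^ 2) ^ m)
    {w e : EuclideanSpace ℂ (Fin d)} (hw : ‖w‖ = 1) (he : ‖e‖ = 1) :
    m ^ 2 * ∑ j, (‖inner ℂ w (v j)‖ ^ 2) ^ (m - 1) * ‖inner ℂ e (v j)‖ ^ 2 =
      S * (m + m * (m - 1) * ‖inner ℂ w e‖ ^ 2) := by
  have hsq : ∀ z : ℂ, z.re ^ 2 + z.im ^ 2 = ‖z‖ ^ 2 := fun z => by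
    rw [← Complex.normSq_eq_norm_sq, Complex.normSq_apply]; ring
  have h1 := sum_second_coeff hS hw he
  have h2 := sum_second_coeff hS hw (e := Complex.I • e) (by simp [norm_smul, he])
  have hn : ∀ x, ‖inner ℂ (Complex.I • e) x‖ = ‖inner ℂ e x‖ := fun x => by
    simp
  have hl : ∀ x, (inner ℂ w x * star (inner ℂ (Complex.I • e) x)).re ^ 2 =
      (inner ℂ w x * star (inner ℂ e x)).im ^ 2 := fun x => by
    rw [inner_smul_left, ← starRingEnd_apply, ← starRingEnd_apply, map_mul, Complex.conj_conj,
      mul_left_comm, Complex.I_mul_re, neg_sq]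
  have hr : (inner ℂ w (Complex.I • e)).re ^ 2 = (inner ℂ w e).im ^ 2 := by
    rw [inner_smul_right, Complex.I_mul_re, neg_sq]
  simp only [hn, hl, hr] at h2
  have h3 := congrArg₂ (· + ·) h1 h2
  simp only [← Finset.sum_add_distrib] at h3
  have h4 : ∀ j, 2 * m * (‖inner ℂ w (v j)‖ ^ 2) ^ (m - 1) * ‖inner ℂ e (v j)‖ ^ 2 +
        4 * (m * (m - 1)) * (‖inner ℂ w (v j)‖ ^ 2) ^ (m - 2) *
          (inner ℂ w (v j) * star (inner ℂ e (v j))).re ^ 2 +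
      (2 * m * (‖inner ℂ w (v j)‖ ^ 2) ^ (m - 1) * ‖inner ℂ e (v j)‖ ^ 2 +
        4 * (m * (m - 1)) * (‖inner ℂ w (v j)‖ ^ 2) ^ (m - 2) *
          (inner ℂ w (v j) * star (inner ℂ e (v j))).im ^ 2) =
      4 * (m ^ 2 * ((‖inner ℂ w (v j)‖ ^ 2) ^ (m - 1) * ‖inner ℂ e (v j)‖ ^ 2)) := by
    intro j
    have h5 := hsq (inner ℂ w (v j) * star (inner ℂ e (v j)))
    rw [norm_mul, norm_star, mul_pow] at h5
    rcases m with _ | _ | m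
    · simp
    · simp; ring
    · simp only [show m + 1 + 1 - 1 = m + 1 from rfl, show m + 1 + 1 - 2 = m from rfl]
      push_cast
      linear_combination (4 * (((m : ℝ) + 1 + 1) * (m + 1 + 1 - 1)) *
        (‖inner ℂ w (v j)‖ ^ 2) ^ m) * h5
  rw [Finset.sum_congr rfl fun j _ => h4 j, ← Finset.mul_sum, ← Finset.mul_sum] at h3
  linear_combination h3 / 4 + S * (m * (m - 1)) * hsq (inner ℂ w e)

/-- Summing over an orthonormal basis of directions `e` amounts to taking a Laplacian; Parseval then
removes every `e`-dependent factor. -/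
theorem moment_recursion {m : ℕ} {S : ℝ} (hm : m ≠ 0)
    (hS : ∀ w : EuclideanSpace ℂ (Fin d), ∑ j, (‖inner ℂ w (v j)‖ ^ 2) ^ m = S * (‖w‖ ^ 2) ^ m)
    (hv : ∀ j, ‖v j‖ = 1) {w : EuclideanSpace ℂ (Fin d)} (hw : ‖w‖ = 1) :
    m * ∑ j, (‖inner ℂ w (v j)‖ ^ 2) ^ (m - 1) = S * (d + (m - 1)) := by
  have hm' : (m : ℝ) ≠ 0 := Nat.cast_ne_zero.2 hm
  let b := EuclideanSpace.basisFun (Fin d) ℂ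
  have h := Finset.sum_congr rfl fun (i : Fin d) (_ : i ∈ Finset.univ) =>
    sum_second_coeff_average hS hw (b.norm_eq_one i)
  rw [← Finset.mul_sum, Finset.sum_comm] at h
  simp only [← Finset.mul_sum, b.sum_sq_norm_inner_right, Finset.sum_add_distrib,
    b.sum_sq_norm_inner_left, hv, hw] at h
  simp only [one_pow, mul_one, Finset.sum_const, Finset.card_univ, Fintype.card_fin,
    nsmul_eq_mul] at h
  apply mul_left_cancel₀ hm'
  linear_combination h

end Moments

/-! ### Beta moments and orthogonality of Jacobi polynomials. -/

section Beta

open Nat in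
/-- The linear functional `X ^ m ↦ m! q! / (m + q)!`, which for `q ≥ 1` is integration against
`q (1 - x) ^ (q - 1)` on `[0, 1]`. -/
noncomputable def betaFunctional (q : ℕ) : ℝ[X] →ₗ[ℝ] ℝ :=
  lsum fun m => ((m ! * q ! : ℝ) / (m + q)!) • LinearMap.id

open Nat in
theorem betaFunctional_X_pow (q m : ℕ) :
    betaFunctional q (X ^ m) = (m ! * q ! : ℝ) / (m + q)! := by
  rw [X_pow_eq_monomial]
  change (monomial m (1 : ℝ)).sum _ = _
  rw [sum_monomial_index] <;> simp

open Nat in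
theorem betaFunctional_X_pow_mul_one_sub_X_pow (q a b : ℕ) :
    betaFunctional q (X ^ a * (1 - X) ^ b) =
      (a ! * q ! * (ascPochhammer ℝ b).eval (q : ℝ)) / (a + b + q)! := by
  induction b generalizing a with
  | zero => simp [betaFunctional_X_pow]
  | succ b ih =>
    have h : (X ^ a * (1 - X) ^ (b + 1) : ℝ[X]) =
        X ^ a * (1 - X) ^ b - X ^ (a + 1) * (1 - X) ^ b := by ring
    rw [h, map_sub, ih, ih, ascPochhammer_succ_eval,
      show a + 1 + b + q = a + b + q + 1 by ring, show a + (b + 1) + q = a + b + q + 1 by ring,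
      Nat.factorial_succ, Nat.factorial_succ]
    have h1 : ((a + b + q)! : ℝ) ≠ 0 := Nat.cast_ne_zero.2 (Nat.factorial_ne_zero _)
    have h2 : ((a : ℝ) + b + q + 1) ≠ 0 := by positivity
    push_cast
    field_simp
    ring

open Nat in
theorem ascPochhammer_eval_cast_add_one (N k : ℕ) :
    (ascPochhammer ℝ k).eval ((N : ℝ) + 1) = ((N + k)! : ℝ) / N ! := by
  have h1 : (N ! : ℝ) ≠ 0 := Nat.cast_ne_zero.2 (Nat.factorial_ne_zero _)
  rw [eq_div_iff h1, ← Nat.factorial_mul_ascFactorial, ← ascPochhammer_nat_eq_ascFactorial]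
  push_cast
  ring

/-- Up to sign this is a `t`-th finite difference, which kills degrees below `t`. -/
theorem sum_neg_one_pow_mul_choose_mul_eval {p : ℝ[X]} {t : ℕ} (hp : p.natDegree < t) :
    ∑ k ∈ Finset.range (t + 1), (-1 : ℝ) ^ k * t.choose k * p.eval (k : ℝ) = 0 := by
  have h := congrFun (Polynomial.fwdDiff_iter_eq_zero_of_degree_lt hp) 0
  rw [fwdDiff_iter_eq_sum_shift] at h
  have h1 := congrArg (fun x => (-1 : ℝ) ^ t * x) h
  simp only [Pi.zero_apply, mul_zero, Finset.mul_sum] at h1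
  rw [← h1]
  refine Finset.sum_congr rfl fun k hk => ?_
  obtain ⟨i, rfl⟩ := Nat.exists_eq_add_of_le (Nat.lt_succ_iff.1 (Finset.mem_range.1 hk))
  have h2 : (-1 : ℝ) ^ i * (-1) ^ i = 1 := by rw [← mul_pow]; simp
  simp only [Nat.add_sub_cancel_left, zsmul_eq_mul, nsmul_eq_mul, mul_one, zero_add]
  push_cast
  rw [pow_add]
  linear_combination (-(-1 : ℝ) ^ k * (k + i).choose k * p.eval (k : ℝ)) * h2

/-- The coefficients of the shifted Jacobi polynomial in powers of `X - 1`. -/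
noncomputable def jacobiCoeff (n : ℕ) (α β : ℝ) (k : ℕ) : ℝ :=
  (ascPochhammer ℝ k).eval (n + α + β + 1) * (ascPochhammer ℝ (n - k)).eval (α + k + 1)
        / (k.factorial * (n - k).factorial)

theorem jacobiPoly_comp (n : ℕ) (α β : ℝ) :
    (jacobiPoly n α β).comp (2 * X - 1) =
      ∑ k ∈ Finset.range (n + 1), C (jacobiCoeff n α β k) * (X - 1) ^ k := by
  have h : (C (1 / 2) * (2 * X - 1 - 1) : ℝ[X]) = X - 1 := by
    have : (C (1 / 2) * 2 : ℝ[X]) = 1 := by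
      rw [← C_ofNat, ← C_mul]; norm_num
    linear_combination (X - 1) * this
  simp only [jacobiPoly, Polynomial.sum_comp, mul_comp, pow_comp, sub_comp, C_comp, X_comp, one_comp]
  exact Finset.sum_congr rfl fun k _ => by rw [h]; rfl

theorem natDegree_jacobiPoly_comp_le (n : ℕ) (α β : ℝ) :
    ((jacobiPoly n α β).comp (2 * X - 1)).natDegree ≤ n := by
  rw [jacobiPoly_comp]
  refine natDegree_sum_le_of_forall_le _ _ fun k hk => ?_
  refine (natDegree_C_mul_le _ _).trans ?_
  rw [← C_1, natDegree_pow, natDegree_X_sub_C, mul_one]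
  exact Nat.lt_succ_iff.1 (Finset.mem_range.1 hk)

theorem coeff_jacobiPoly_comp (n : ℕ) (α β : ℝ) :
    ((jacobiPoly n α β).comp (2 * X - 1)).coeff n = jacobiCoeff n α β n := by
  rw [jacobiPoly_comp, finsetSum_coeff, Finset.sum_range_succ, Finset.sum_eq_zero, zero_add,
    coeff_C_mul]
  · have h := ((monic_X_sub_C (1 : ℝ)).pow n).coeff_natDegree
    rw [natDegree_pow, natDegree_X_sub_C, mul_one, C_1] at h
    rw [h, mul_one]
  · intro k hk
    rw [coeff_C_mul, coeff_eq_zero_of_natDegree_lt, mul_zero]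
    rw [← C_1, natDegree_pow, natDegree_X_sub_C, mul_one]
    exact Finset.mem_range.1 hk

open Nat in
-- Expanding in powers of `1 - X`, the `k`-th term is a common constant times `(-1)^k (t choose k)`
-- times a polynomial in `k` of degree `t - 1 - l`, so the sum is a vanishing finite difference.
theorem betaFunctional_jacobiPoly_mul_X_pow (q ε t : ℕ) {l : ℕ} (hl : l < t) :
    betaFunctional q
      (X ^ ε * (1 - X) * (jacobiPoly t (q : ℝ) (ε : ℝ)).comp (2 * X - 1) * X ^ l) = 0 := by
  -- At `k` this polynomial equals `(t + q + ε + k)! / (ε + l + k + 1 + q)!`, the quotient left by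
  -- the Jacobi coefficient and the beta moment.
  have hp : ((ascPochhammer ℝ (t - 1 - l)).comp (X + C ((ε + l + 1 + q : ℕ) + 1 : ℝ))).natDegree
      < t := by
    rw [natDegree_comp, natDegree_X_add_C, mul_one, ascPochhammer_natDegree]
    omega
  have hsum := sum_neg_one_pow_mul_choose_mul_eval hp
  have hexp : (X ^ ε * (1 - X) * (jacobiPoly t (q : ℝ) (ε : ℝ)).comp (2 * X - 1) * X ^ l : ℝ[X]) =
      ∑ k ∈ Finset.range (t + 1),
        ((-1) ^ k * jacobiCoeff t q ε k) • (X ^ (ε + l) * (1 - X) ^ (k + 1)) := by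
    rw [jacobiPoly_comp, Finset.mul_sum, Finset.sum_mul]
    refine Finset.sum_congr rfl fun k _ => ?_
    rw [smul_eq_C_mul, C_mul, C_pow, C_neg, C_1, ← neg_sub (1 : ℝ[X]) X, neg_pow (1 - X : ℝ[X])]
    ring
  rw [hexp, map_sum]
  have hterm : ∀ k ∈ Finset.range (t + 1),
      betaFunctional q (((-1) ^ k * jacobiCoeff t q ε k) • (X ^ (ε + l) * (1 - X) ^ (k + 1))) =
      ((ε + l)! * q ! * (ascPochhammer ℝ (t + 1)).eval (q : ℝ) / (t ! * (t + q + ε)!)) *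
        ((-1 : ℝ) ^ k * t.choose k *
          ((ascPochhammer ℝ (t - 1 - l)).comp
            (X + C ((ε + l + 1 + q : ℕ) + 1 : ℝ))).eval (k : ℝ)) := by
    intro k hk
    have hk' : k ≤ t := Nat.lt_succ_iff.1 (Finset.mem_range.1 hk)
    have h1 : (ascPochhammer ℝ (t + 1)).eval (q : ℝ) =
        (ascPochhammer ℝ (k + 1)).eval (q : ℝ) *
          (ascPochhammer ℝ (t - k)).eval ((q : ℝ) + k + 1) := by
      have := ascPochhammer_mul ℝ (k + 1) (t - k)
      rw [show k + 1 + (t - k) = t + 1 by omega] at this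
      rw [← this]
      simp [add_assoc]
    have h2 : (ascPochhammer ℝ k).eval ((t : ℝ) + q + ε + 1) =
        ((t + q + ε + k)! : ℝ) / (t + q + ε)! := by
      rw [← ascPochhammer_eval_cast_add_one]
      push_cast
      rfl
    have h3 : (ascPochhammer ℝ (t - 1 - l)).eval ((k : ℝ) + ((ε + l + 1 + q : ℕ) + 1)) =
        ((t + q + ε + k)! : ℝ) / (ε + l + (k + 1) + q)! := by
      rw [show t + q + ε + k = ε + l + (k + 1) + q + (t - 1 - l) by omega,
        ← ascPochhammer_eval_cast_add_one]
      congr 1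
      push_cast
      ring
    have h4 : (t.choose k : ℝ) = (t ! : ℝ) / (k ! * (t - k)!) := Nat.cast_choose ℝ hk'
    rw [map_smul, betaFunctional_X_pow_mul_one_sub_X_pow, smul_eq_mul, eval_comp, eval_add, eval_X,
      eval_C, h3, h1, h4, jacobiCoeff, h2]
    have e1 : (t ! : ℝ) ≠ 0 := Nat.cast_ne_zero.2 (Nat.factorial_ne_zero _)
    field_simp
  rw [Finset.sum_congr rfl hterm, ← Finset.mul_sum, hsum, mul_zero]

theorem betaFunctional_jacobiPoly_mul (q ε t : ℕ) {p : ℝ[X]} (hp : p.natDegree < t) :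
    betaFunctional q
      (X ^ ε * (1 - X) * (jacobiPoly t (q : ℝ) (ε : ℝ)).comp (2 * X - 1) * p) = 0 := by
  rw [p.as_sum_range' t hp, Finset.mul_sum, map_sum]
  refine Finset.sum_eq_zero fun l hl => ?_
  rw [← C_mul_X_pow_eq_monomial, mul_left_comm, ← smul_eq_C_mul, map_smul,
    betaFunctional_jacobiPoly_mul_X_pow q ε t (Finset.mem_range.1 hl), smul_zero]

end Beta

/-! ### The design property forces the angles to be Jacobi roots. -/

section Design

variable {q n : ℕ} {v : Fin n → EuclideanSpace ℂ (Fin (q + 1))}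

/-- Scaling extends the identity off the sphere, as differentiation along `w + r e` requires. -/
theorem sum_pow_homogeneous {m : ℕ} {w : EuclideanSpace ℂ (Fin (q + 1))}
    (hS : ∀ u : EuclideanSpace ℂ (Fin (q + 1)), ‖u‖ = 1 →
      ∑ j, (‖inner ℂ u (v j)‖ ^ 2) ^ m = ∑ j, (‖inner ℂ w (v j)‖ ^ 2) ^ m) (hw : ‖w‖ = 1)
    (x : EuclideanSpace ℂ (Fin (q + 1))) :
    ∑ j, (‖inner ℂ x (v j)‖ ^ 2) ^ m =
      (∑ j, (‖inner ℂ w (v j)‖ ^ 2) ^ m) * (‖x‖ ^ 2) ^ m := by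
  obtain ⟨u, hu, hx⟩ : ∃ u : EuclideanSpace ℂ (Fin (q + 1)), ‖u‖ = 1 ∧ x = (‖x‖ : ℂ) • u := by
    by_cases h0 : x = 0
    · exact ⟨w, hw, by simp [h0]⟩
    · have h1 : (‖x‖ : ℂ) ≠ 0 := by simpa using h0
      exact ⟨(‖x‖ : ℂ)⁻¹ • x, by simp [norm_smul, h0], by rw [smul_inv_smul₀ h1]⟩
  rw [← hS u hu, Finset.sum_mul]
  refine Finset.sum_congr rfl fun j _ => ?_
  conv_lhs => rw [hx]
  rw [inner_smul_left, norm_mul, Complex.conj_ofReal, Complex.norm_real, norm_norm]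
  ring

open Nat in
theorem sum_pow_eq_of_forall_unit {M : ℕ} (hv : ∀ j, ‖v j‖ = 1)
    (hS : ∀ m ≤ M, ∀ u w : EuclideanSpace ℂ (Fin (q + 1)), ‖u‖ = 1 → ‖w‖ = 1 →
      ∑ j, (‖inner ℂ u (v j)‖ ^ 2) ^ m = ∑ j, (‖inner ℂ w (v j)‖ ^ 2) ^ m)
    {w : EuclideanSpace ℂ (Fin (q + 1))} (hw : ‖w‖ = 1) {m : ℕ} (hm : m ≤ M) :
    ∑ j, (‖inner ℂ w (v j)‖ ^ 2) ^ m = n * ((m ! * q ! : ℝ) / (m + q)!) := by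
  induction m with
  | zero =>
    have : (q ! : ℝ) ≠ 0 := Nat.cast_ne_zero.2 (Nat.factorial_ne_zero _)
    simp [this]
  | succ m ih =>
    have h := moment_recursion (Nat.succ_ne_zero m)
      (sum_pow_homogeneous (fun u hu => hS (m + 1) hm u w hu hw) hw) hv hw
    rw [Nat.succ_sub_one, ih (by omega)] at h
    have h1 : ((m + q : ℕ) : ℝ) + 1 ≠ 0 := by positivity
    rw [show m + 1 + q = m + q + 1 by ring, Nat.factorial_succ, Nat.factorial_succ]
    have h2 : ((m + q)! : ℝ) ≠ 0 := Nat.cast_ne_zero.2 (Nat.factorial_ne_zero _)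
    apply mul_right_cancel₀ h1
    push_cast at h h1 ⊢
    rw [show ((m : ℝ) + q + 1) = (q + 1 + (m + 1 - 1)) by ring, ← h]
    rw [show ((q : ℝ) + 1 + (m + 1 - 1)) = m + q + 1 by ring]
    field_simp

theorem sum_eval_eq_betaFunctional {M : ℕ} (hv : ∀ j, ‖v j‖ = 1)
    (hS : ∀ m ≤ M, ∀ u w : EuclideanSpace ℂ (Fin (q + 1)), ‖u‖ = 1 → ‖w‖ = 1 →
      ∑ j, (‖inner ℂ u (v j)‖ ^ 2) ^ m = ∑ j, (‖inner ℂ w (v j)‖ ^ 2) ^ m)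
    {w : EuclideanSpace ℂ (Fin (q + 1))} (hw : ‖w‖ = 1) {p : ℝ[X]} (hp : p.natDegree ≤ M) :
    ∑ j, p.eval (‖inner ℂ w (v j)‖ ^ 2) = n * betaFunctional q p := by
  conv_rhs => rw [p.as_sum_range' (M + 1) (Nat.lt_succ_of_le hp)]
  simp only [eval_eq_sum_range' (Nat.lt_succ_of_le hp)]
  rw [Finset.sum_comm, map_sum, Finset.mul_sum]
  refine Finset.sum_congr rfl fun m hm => ?_
  rw [← Finset.mul_sum, sum_pow_eq_of_forall_unit hv hS hw
      (Nat.lt_succ_iff.1 (Finset.mem_range.1 hm)),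
    ← C_mul_X_pow_eq_monomial, ← smul_eq_C_mul, map_smul, betaFunctional_X_pow, smul_eq_mul]
  ring

theorem IsAngularSet.isRoot_of_tight {A : Finset ℝ} (hv : IsAngularSet v A)
    (hn : n = Module.finrank ℂ
      (sphereHom (q + 1) (angleEps A + (A.erase 0).card) (A.erase 0).card))
    {k j : Fin n} (hkj : k ≠ j) :
    (X ^ angleEps A * (jacobiPoly (A.erase 0).card (q : ℝ) (angleEps A : ℝ)).comp
      (2 * X - 1)).IsRoot (‖inner ℂ (v k) (v j)‖ ^ 2) := by
  set ε := angleEps A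
  set t := (A.erase 0).card with ht
  set J := (jacobiPoly t (q : ℝ) (ε : ℝ)).comp (2 * X - 1) with hJ
  have hc : J.coeff t ≠ 0 := by
    rw [hJ, coeff_jacobiPoly_comp, jacobiCoeff,
      show (t : ℝ) + q + ε + 1 = ((t + q + ε : ℕ) : ℝ) + 1 by push_cast; ring,
      ascPochhammer_eval_cast_add_one, Nat.sub_self, ascPochhammer_zero, eval_one]
    positivity
  set D := annihilator A - C (J.coeff t)⁻¹ * J with hD
  have hJdeg : J.natDegree ≤ t := natDegree_jacobiPoly_comp_le _ _ _
  have hDdeg : D.natDegree ≤ t := (natDegree_sub_le _ _).trans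
    (max_le (natDegree_annihilator A).le ((natDegree_C_mul_le _ _).trans hJdeg))
  have hDt : D.coeff t = 0 := by
    have := (monic_annihilator A).coeff_natDegree
    rw [natDegree_annihilator, ← ht] at this
    rw [hD, coeff_sub, coeff_C_mul, this, inv_mul_cancel₀ hc, sub_self]
  have hann : ∀ i, i ≠ k → (‖inner ℂ (v k) (v i)‖ ^ 2) ^ ε *
      (annihilator A).eval (‖inner ℂ (v k) (v i)‖ ^ 2) = 0 := fun i hi =>
    pow_angleEps_mul_annihilator (hv.angle_mem k i hi.symm)
  have hDj : (‖inner ℂ (v k) (v j)‖ ^ 2) ^ ε * D.eval (‖inner ℂ (v k) (v j)‖ ^ 2) = 0 := by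
    -- This covers `t = 0`, where no `natDegree` lies strictly below `t`.
    by_cases hD0 : D = 0
    · simp [hD0]
    have hDlt : D.natDegree < t := lt_of_le_of_ne hDdeg fun h =>
      hD0 (leadingCoeff_eq_zero.1 (by rw [leadingCoeff, h, hDt]))
    have h1 : ∑ i, (X ^ ε * (1 - X) * J * D).eval (‖inner ℂ (v k) (v i)‖ ^ 2) = 0 := by
      -- The degree lost by `D` pays for the factor `1 - X`, so the product just stays within the
      -- design strength.
      have hdeg : (X ^ ε * (1 - X) * J * D).natDegree ≤ ε + 2 * t := by
        have e1 : (1 - X : ℝ[X]).natDegree ≤ 1 := by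
          refine (natDegree_sub_le _ _).trans ?_
          simp
        have e2 := natDegree_mul_le (p := X ^ ε * (1 - X) * J) (q := D)
        have e3 := natDegree_mul_le (p := X ^ ε * (1 - X)) (q := J)
        have e4 := natDegree_mul_le (p := (X : ℝ[X]) ^ ε) (q := 1 - X)
        rw [natDegree_X_pow] at e4
        omega
      rw [sum_eval_eq_betaFunctional hv.norm_eq_one
        (fun m hm u w hu hw => hv.sum_pow_eq_of_tight hn hm hu hw) (hv.norm_eq_one k) hdeg,
        betaFunctional_jacobiPoly_mul q ε t hDlt, mul_zero]
    -- One factor `D` may be replaced by `-J / lc(J)`: the annihilator part dies at `i ≠ k` by the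
    -- choice of `A`, and at `i = k` because `1 - x = 0`.
    have h2 : ∑ i, (‖inner ℂ (v k) (v i)‖ ^ 2) ^ ε * (1 - ‖inner ℂ (v k) (v i)‖ ^ 2) *
        D.eval (‖inner ℂ (v k) (v i)‖ ^ 2) ^ 2 = 0 := by
      rw [← mul_zero (-(J.coeff t)⁻¹), ← h1, Finset.mul_sum]
      refine Finset.sum_congr rfl fun i _ => ?_
      have h3 : (‖inner ℂ (v k) (v i)‖ ^ 2) ^ ε * (1 - ‖inner ℂ (v k) (v i)‖ ^ 2) *
          (annihilator A).eval (‖inner ℂ (v k) (v i)‖ ^ 2) = 0 := by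
        by_cases hi : i = k
        · subst hi
          simp [inner_self_eq_norm_sq_to_K, hv.norm_eq_one]
        · rw [mul_right_comm, hann i hi, zero_mul]
      have h4 : D.eval (‖inner ℂ (v k) (v i)‖ ^ 2) =
          (annihilator A).eval (‖inner ℂ (v k) (v i)‖ ^ 2) -
            (J.coeff t)⁻¹ * J.eval (‖inner ℂ (v k) (v i)‖ ^ 2) := by simp [hD]
      simp only [eval_mul, eval_pow, eval_sub, eval_X, eval_one]
      rw [sq (D.eval _)]
      nth_rewrite 1 [h4]
      linear_combination D.eval (‖inner ℂ (v k) (v i)‖ ^ 2) * h3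
    rw [Finset.sum_eq_zero_iff_of_nonneg] at h2
    · have h5 := h2 j (Finset.mem_univ j)
      have h6 := (hv.subset_Ico _ (hv.angle_mem k j hkj)).2
      rw [mul_right_comm, mul_eq_zero, or_iff_left (by linarith)] at h5
      rcases mul_eq_zero.1 h5 with h | h
      · rw [h, zero_mul]
      · rw [pow_eq_zero_iff two_ne_zero] at h
        rw [h, mul_zero]
    · intro i _
      have h7 : ‖inner ℂ (v k) (v i)‖ ^ 2 ≤ 1 := by
        have := norm_inner_le_norm (𝕜 := ℂ) (v k) (v i)
        rw [hv.norm_eq_one, hv.norm_eq_one, one_mul] at this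
        exact pow_le_one₀ (norm_nonneg _) this
      have h8 := sub_nonneg.2 h7
      positivity
  have h9 := hann j hkj.symm
  have h10 : (annihilator A).eval (‖inner ℂ (v k) (v j)‖ ^ 2) =
      D.eval (‖inner ℂ (v k) (v j)‖ ^ 2) +
        (J.coeff t)⁻¹ * J.eval (‖inner ℂ (v k) (v j)‖ ^ 2) := by simp [hD]
  rw [h10, mul_add, hDj, zero_add, mul_left_comm, mul_eq_zero,
    or_iff_right (inv_ne_zero hc)] at h9
  simpa [IsRoot] using h9

end Design

/-! ### The bound and its equality case. -/

theorem mainTheorem12 (d n s : ℕ) (hd : 1 ≤ d) (v : Fin n → EuclideanSpace ℂ (Fin d))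
    (A : Finset ℝ) (hs : A.card = s) (hv : IsAngularSet v A) :
    n ≤ (s + d - 1).choose (d - 1) * (s - angleEps A + d - 1).choose (d - 1) ∧
      (n = (s + d - 1).choose (d - 1) * (s - angleEps A + d - 1).choose (d - 1) →
        ∀ j k, j ≠ k →
          (tightAngularPoly d s (angleEps A)).IsRoot (‖inner ℂ (v j) (v k)‖ ^ 2)) := by
  have hst := card_eq_angleEps_add A
  rw [hs] at hst
  have ht : s - angleEps A = (A.erase 0).card := by omega
  have h1 := hv.card_le_finrank
  have h2 := finrank_sphereHom_le (a := angleEps A + (A.erase 0).card) (b := (A.erase 0).card) hd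
  rw [← hst] at h1 h2
  rw [tightAngularPoly, ht]
  refine ⟨h1.trans h2, fun hn j k hjk => ?_⟩
  obtain ⟨q, rfl⟩ := Nat.exists_eq_add_of_le' hd
  have h3 := hv.isRoot_of_tight (by rw [← hst]; omega) hjk
  rwa [show ((q + 1 : ℕ) : ℝ) - 1 = q by push_cast; ring]
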